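/- Let $k$ be a field of characteristic different from $2$ and $3$, let $\Gamma$ be a commutative group, and let $\varepsilon:\Gamma\times\Gamma\to k\setminus\{0\}$ be a commutation factor, i.e. $\varepsilon(\alpha+\beta,\gamma)=\varepsilon(\alpha,\gamma)\varepsilon(\beta,\gamma)$, $\varepsilon(\alpha,\beta+\gamma)=\varepsilon(\alpha,\beta)\varepsilon(\alpha,\gamma)$ and $\varepsilon(\alpha,\beta)\varepsilon(\beta,\alpha)=1$. Let $g=\bigoplus_{\gamma\in\Gamma}g_\gamma$ be an $n$-dimensional abelian color Lie algebra (a $\Gamma$-graded $\varepsilon$-Lie algebra with zero bracket). Let $A=U(g)$ be its universal enveloping algebra, i.e. the quotient of the tensor algebra $T(g)$ by the relations $ab=\varepsilon(\alpha,\beta)ba$ for $a\in g_\alpha$, $b\in g_\beta$, and let $A_i\subseteq A$ be the span of the products of $i$ elements of $g$. Definitions. A graded $k$-algebra $R=\bigoplus_{i\ge0}R_i$ is standard if $R_0=k$, every $R_i$ is finite-dimensional, and $R$ is generated by $R_1$ as a unital algebra; put $R_+=\bigoplus_{i\ge1}R_i$. For $x\in R$ and a right ideal $J$ put $(x:J)=\{a\in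 R\mid xa\in J\}$. A Koszul filtration in $R$ is a set $\mathbf F$ of right ideals, each generated by elements of $R_1$, such that $0,R_+\in\mathbf F$ and for every $0\neq I\in\mathbf F$ there are $J\in\mathbf F$, $J\ne I$, and $x\in R_1$ with $I=J+xR$ and $(x:J)\in\mathbf F$. A Groebner flag is a Koszul filtration that is a complete flag $0=I_0\subset I_1\subset\dots\subset I_m=R_+$ (strict inclusions, $m=\dim R_1$). A standard algebra is initially Koszul if it has a Groebner flag; it is initially Koszul with respect to a basis $x_1,\dots,x_m$ of $R_1$ if the right ideals $I_i=x_1R+\dots+x_iR$, $0\le i\le m$, form a Groebner flag. It is strongly Koszul if $R_1$ has a basis $X$ such that for every $Y\subseteq X$ and every $x\in X\setminus Y$ the right ideal $(x:YR)$ is generated by a subset of $X$. Proposition. With the grading $(A_i)_{i\ge 0}$, $A=U(g)$ is a standard graded algebra, and: 1. $A$ is initially Koszul, i.e. it has a Groebner flag. 2. For every sequence $x_1,\dots,x_n$ of $\Gamma$-homogeneous elements spanning $g$ (equivalently, every $\Gamma$-homogeneous basis of $g$ in any order), the images of $x_1,\dots,x_n$ in $A$ form a basis of $A_1$, and $A$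 is initially Koszul with respect to it. (This is the sense in which $A$ is universally initially Koszul.) 3. $A$ is strongly Koszul. -/

import Mathlib

namespace ColorKoszul

/-! ### Koszul filtrations and Groebner flags in graded associative algebras -/

section Graded

/-- Right ideals of a ring `R`. -/
abbrev RightIdeal (R : Type*) [Ring R] := Submodule Rᵐᵒᵖ R

/-- The right ideal generated by a set. -/
abbrev rightSpan {R : Type*} [Ring R] (S : Set R) : RightIdeal R := Submodule.span Rᵐᵒᵖ S

/-- The right ideal `(x : J) = {a ∈ R | x a ∈ J}`. -/
def rightColon {R : Type*} [Ring R] (x : R) (J : RightIdeal R) : RightIdeal R where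
  carrier := {a | x * a ∈ J}
  add_mem' := by
    intro a b ha hb
    simpa [mul_add] using J.add_mem ha hb
  zero_mem' := by simp
  smul_mem' := by
    intro c a ha
    have h := J.smul_mem c ha
    simpa [MulOpposite.smul_eq_mul_unop, mul_assoc] using h

variable {k R : Type*} [Field k] [Ring R] [Algebra k R]

/-- The family `𝒜` is a grading `R = ⨁ 𝒜 i` that makes `R` a standard algebra: all components are
finite-dimensional, `𝒜 0 = k`, and `R` is generated as a unital algebra by `𝒜 1`. -/
structure IsStandardGraded (𝒜 : ℕ → Submodule k R) : Prop where
  gradedMonoid : SetLike.GradedMonoid 𝒜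
  isInternal : DirectSum.IsInternal 𝒜
  finite : ∀ i, Module.Finite k (𝒜 i)
  nontrivial : Nontrivial R
  zero_eq : 𝒜 0 = LinearMap.range (Algebra.linearMap k R)
  adjoin_one : Algebra.adjoin k (𝒜 1 : Set R) = ⊤

/-- The augmentation ideal `R_+ = 𝒜 1 ⊕ 𝒜 2 ⊕ …`, as a right ideal. -/
def augmentationIdeal (𝒜 : ℕ → Submodule k R) : RightIdeal R :=
  rightSpan (⋃ i : ℕ, (𝒜 (i + 1) : Set R))

/-- A Koszul filtration: a set `F` of right ideals generated in degree one, containing `0` and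
`R_+`, such that every nonzero `I ∈ F` is `J + xR` for some `J ∈ F`, `J ≠ I`, and some `x` of
degree one with `(x : J) ∈ F`. -/
structure IsKoszulFiltration (𝒜 : ℕ → Submodule k R) (F : Set (RightIdeal R)) : Prop where
  degree_one_generated : ∀ I ∈ F, ∃ S : Set R, S ⊆ 𝒜 1 ∧ I = rightSpan S
  bot_mem : ⊥ ∈ F
  augmentation_mem : augmentationIdeal 𝒜 ∈ F
  step : ∀ I ∈ F, I ≠ ⊥ → ∃ J ∈ F, I ≠ J ∧ ∃ x ∈ 𝒜 1,
    I = J ⊔ rightSpan {x} ∧ rightColon x J ∈ F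

/-- A Groebner flag: a complete flag `0 = I₀ ⊂ I₁ ⊂ … ⊂ Iₙ = R_+`, with `n = dim 𝒜 1`, of right
ideals whose members form a Koszul filtration. -/
structure IsGroebnerFlag (𝒜 : ℕ → Submodule k R) {n : ℕ} (I : Fin (n + 1) → RightIdeal R) :
    Prop where
  finrank_eq : Module.finrank k (𝒜 1) = n
  strictMono : StrictMono I
  zero_eq : I 0 = ⊥
  last_eq : I (Fin.last n) = augmentationIdeal 𝒜
  isKoszulFiltration : IsKoszulFiltration 𝒜 (Set.range I)

/-- A standard algebra is initially Koszul if it has a Groebner flag. -/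
def IsInitiallyKoszul (𝒜 : ℕ → Submodule k R) : Prop :=
  IsStandardGraded 𝒜 ∧ ∃ (n : ℕ) (I : Fin (n + 1) → RightIdeal R), IsGroebnerFlag 𝒜 I

/-- The finite sequence `x` is a vector space basis of the component `𝒜 1`. -/
def IsDegreeOneBasis (𝒜 : ℕ → Submodule k R) {n : ℕ} (x : Fin n → R) : Prop :=
  LinearIndependent k x ∧ Submodule.span k (Set.range x) = 𝒜 1

/-- The right ideals `Iᵢ = x₁R + … + xᵢR`, for `0 ≤ i ≤ n`. -/
def flagOf {n : ℕ} (x : Fin n → R) (i : Fin (n + 1)) : RightIdeal R :=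
  rightSpan (x '' {j | (j : ℕ) < i})

/-- A standard algebra is initially Koszul with respect to a basis `x₁, …, xₙ` of its degree one
component if the right ideals `x₁R + … + xᵢR` form a Groebner flag. -/
def IsInitiallyKoszulWRT (𝒜 : ℕ → Submodule k R) {n : ℕ} (x : Fin n → R) : Prop :=
  IsStandardGraded 𝒜 ∧ IsDegreeOneBasis 𝒜 x ∧ IsGroebnerFlag 𝒜 (flagOf x)

/-- A standard algebra is strongly Koszul if its degree one component has a basis `x₁, …, xₙ`
such that, for every subset `Y` of it and every `xⱼ ∉ Y`, the right ideal `(xⱼ : YR)` is generated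
by a subset of `{x₁, …, xₙ}`. -/
def IsStronglyKoszul (𝒜 : ℕ → Submodule k R) : Prop :=
  IsStandardGraded 𝒜 ∧ ∃ (n : ℕ) (x : Fin n → R), IsDegreeOneBasis 𝒜 x ∧
    ∀ (Y : Set (Fin n)) (j : Fin n), j ∉ Y →
      ∃ Z : Set (Fin n), rightColon (x j) (rightSpan (x '' Y)) = rightSpan (x '' Z)

end Graded

/-! ### Color Lie algebras and their universal enveloping algebras -/

/-- A commutation factor on the commutative group `Γ` with values in `k \ {0}`. -/
structure CommutationFactor (k Γ : Type*) [Field k] [AddCommGroup Γ] where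
  toFun : Γ → Γ → kˣ
  add_left : ∀ α β γ, toFun (α + β) γ = toFun α γ * toFun β γ
  add_right : ∀ α β γ, toFun α (β + γ) = toFun α β * toFun α γ
  mul_swap : ∀ α β, toFun α β * toFun β α = 1

instance {k Γ : Type*} [Field k] [AddCommGroup Γ] :
    CoeFun (CommutationFactor k Γ) (fun _ => Γ → Γ → kˣ) := ⟨CommutationFactor.toFun⟩

/-- The structure of a `Γ`-graded `ε`-Lie algebra (a color Lie algebra) on the vector space `g`:
a direct sum decomposition of `g` into homogeneous components and a bilinear bracket. -/
structure ColorLieAlgebra {k Γ : Type*} [Field k] [AddCommGroup Γ] (ε : CommutationFactor k Γ)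
    (g : Type*) [AddCommGroup g] [Module k g] where
  component : Γ → Submodule k g
  independent : iSupIndep component
  iSup_eq_top : ⨆ γ, component γ = ⊤
  bracket : g →ₗ[k] g →ₗ[k] g
  bracket_mem : ∀ α β, ∀ a ∈ component α, ∀ b ∈ component β, bracket a b ∈ component (α + β)
  skew : ∀ α β, ∀ a ∈ component α, ∀ b ∈ component β,
    bracket a b = -((ε α β : k) • bracket b a)
  jacobi : ∀ α β γ, ∀ a ∈ component α, ∀ b ∈ component β, ∀ c ∈ component γ,
    (ε γ α : k) • bracket a (bracket b c) + (ε β γ : k) • bracket c (bracket a b)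
      + (ε α β : k) • bracket b (bracket c a) = 0

namespace ColorLieAlgebra

variable {k Γ : Type*} [Field k] [AddCommGroup Γ] {ε : CommutationFactor k Γ}
  {g : Type*} [AddCommGroup g] [Module k g]

/-- A color Lie algebra is abelian if its bracket vanishes. -/
def IsAbelian (L : ColorLieAlgebra ε g) : Prop := ∀ a b : g, L.bracket a b = 0

/-- An element is homogeneous if it lies in some component. -/
def IsHomogeneous (L : ColorLieAlgebra ε g) (a : g) : Prop := ∃ γ, a ∈ L.component γ

/-- The defining relations `ab - ε(α, β) ba = ⟨a, b⟩`, for `a` of degree `α` and `b` of degree `β`,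
of the universal enveloping algebra as a quotient of the tensor algebra of `g`. -/
inductive EnvelopingRel (L : ColorLieAlgebra ε g) : TensorAlgebra k g → TensorAlgebra k g → Prop
  | bracket (α β : Γ) (a b : g) (ha : a ∈ L.component α) (hb : b ∈ L.component β) :
      EnvelopingRel L
        (TensorAlgebra.ι k a * TensorAlgebra.ι k b
          - (ε α β : k) • (TensorAlgebra.ι k b * TensorAlgebra.ι k a))
        (TensorAlgebra.ι k (L.bracket a b))

/-- The universal enveloping algebra `U(g)`. -/
abbrev Enveloping (L : ColorLieAlgebra ε g) := RingQuot L.EnvelopingRel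

/-- The canonical map `g → U(g)`. -/
def ι (L : ColorLieAlgebra ε g) : g →ₗ[k] L.Enveloping :=
  (RingQuot.mkAlgHom k L.EnvelopingRel).toLinearMap ∘ₗ TensorAlgebra.ι k

/-- The subspace of `U(g)` spanned by the products of `i` elements of `g`. When `g` is abelian, the
defining relations are homogeneous and these are the components of the degree grading of `U(g)`. -/
def degreePart (L : ColorLieAlgebra ε g) (i : ℕ) : Submodule k L.Enveloping :=
  LinearMap.range L.ι ^ i

end ColorLieAlgebra

end ColorKoszul

namespace ColorKoszul

/-! Everything reduces to one computation. For a homogeneous basis `x` of `g`, a set `Y` of indices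
and `j ∉ Y`, the colon ideal of `x j` by the right ideal of `Y` is that same ideal if ε(d j, d j) =
1, and the ideal of `insert j Y` if ε(d j, d j) = -1 (`rightColon_eq_or`). Both are generated by
basis vectors, which is strong Koszulness; for `Y` an initial segment both are members of the flag.

The ideal of `Y` is two-sided and is the kernel of the endomorphism `kill` (`mem_rightSpan_iff`).
Since `kill` fixes `x j`, only the annihilator of `x j` has to be found. A skew derivation `D` with
D(x_j b) = b + c x_j D(b) yields it: zero in the even case, x_j A in the odd case. `D` is an entry
of an algebra map into triangular 2×2 matrices. All maps come from the universal property, so no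
monomial basis of the enveloping algebra is needed. -/

theorem mul_mem_of_mem {R : Type*} [Ring R] {J : RightIdeal R} {a : R} (ha : a ∈ J) (b : R) :
    a * b ∈ J := by
  simpa using J.smul_mem (MulOpposite.op b) ha

/-- Induction principle for a right span, with the ambient ring acting on the right. -/
theorem rightSpan_induction {R : Type*} [Ring R] {S : Set R} {C : R → Prop}
    (zero : C 0) (add : ∀ a b, C a → C b → C (a + b)) (mul : ∀ s ∈ S, ∀ b, C (s * b))
    (a : R) (ha : a ∈ rightSpan S) : C a := by
  -- Quantifying over a right factor lets the scalar case be absorbed into that factor.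
  suffices h : ∀ b, C (a * b) by simpa using h 1
  induction ha using Submodule.span_induction with
  | mem s hs => exact mul s hs
  | zero => simpa using zero
  | add x y _ _ hx hy => intro b; rw [add_mul]; exact add _ _ (hx b) (hy b)
  | smul c x _ hx =>
    intro b
    rw [MulOpposite.smul_eq_mul_unop, mul_assoc]
    exact hx _

namespace CommutationFactor

variable {k Γ : Type*} [Field k] [AddCommGroup Γ] (ε : CommutationFactor k Γ)

theorem coe_mul_swap (α β : Γ) : (ε α β : k) * (ε β α : k) = 1 := by
  rw [← Units.val_mul, ε.mul_swap, Units.val_one]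

theorem self_eq_one_or (α : Γ) : (ε α α : k) = 1 ∨ (ε α α : k) = -1 :=
  mul_self_eq_one_iff.mp (ε.coe_mul_swap α α)

end CommutationFactor

namespace ColorLieAlgebra

variable {k Γ : Type*} [Field k] [AddCommGroup Γ] {ε : CommutationFactor k Γ}
  {g : Type*} [AddCommGroup g] [Module k g] (L : ColorLieAlgebra ε g)

/-! ### Universal property of the enveloping algebra -/

section Lift

/-- The universal enveloping algebra, as a ring. Its semiring structure is the one underlying the
ring structure, whereas the instances found on a `RingQuot` only agree with it after unfolding. -/
def EnvelopingRing : Type _ := L.Enveloping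

noncomputable instance : Ring L.EnvelopingRing := inferInstanceAs (Ring (RingQuot L.EnvelopingRel))

noncomputable instance : Algebra k L.EnvelopingRing :=
  inferInstanceAs (Algebra k (RingQuot L.EnvelopingRel))

/-- The quotient map from the tensor algebra. -/
noncomputable def quotMap : TensorAlgebra k g →ₐ[k] L.EnvelopingRing :=
  RingQuot.mkAlgHom k L.EnvelopingRel

/-- The canonical map of `g` into its enveloping ring. -/
noncomputable def incl : g →ₗ[k] L.EnvelopingRing :=
  L.quotMap.toLinearMap ∘ₗ TensorAlgebra.ι k

theorem incl_apply (a : g) : L.incl a = L.quotMap (TensorAlgebra.ι k a) := rfl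

theorem quotMap_surjective : Function.Surjective L.quotMap :=
  RingQuot.mkAlgHom_surjective k L.EnvelopingRel

theorem quotMap_rel {s t : TensorAlgebra k g} (h : L.EnvelopingRel s t) : L.quotMap s = L.quotMap t :=
  RingQuot.mkAlgHom_rel k h

variable {B : Type*} [Ring B] [Algebra k B]

/-- A linear map satisfies the commutation relations of an abelian color Lie algebra. -/
def Commutes (L : ColorLieAlgebra ε g) (φ : g →ₗ[k] B) : Prop :=
  ∀ α β, ∀ a ∈ L.component α, ∀ b ∈ L.component β, φ a * φ b = (ε α β : k) • (φ b * φ a)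

variable {L}

theorem exists_lift (hL : L.IsAbelian) (φ : g →ₗ[k] B) (hφ : L.Commutes φ) :
    ∃ f : L.EnvelopingRing →ₐ[k] B, ∀ t, f (L.quotMap t) = TensorAlgebra.lift k φ t := by
  have h : ∀ ⦃s t⦄, L.EnvelopingRel s t →
      TensorAlgebra.lift k φ s = TensorAlgebra.lift k φ t := by
    rintro _ _ ⟨α, β, a, b, ha, hb⟩
    simp [hL a b, hφ α β a ha b hb]
  exact ⟨RingQuot.liftAlgHom k ⟨TensorAlgebra.lift k φ, h⟩, fun t =>
    RingQuot.liftAlgHom_mkAlgHom_apply k _ h t⟩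

/-- The universal property of the enveloping algebra of an abelian color Lie algebra. -/
noncomputable def lift (hL : L.IsAbelian) (φ : g →ₗ[k] B) (hφ : L.Commutes φ) :
    L.EnvelopingRing →ₐ[k] B :=
  (exists_lift hL φ hφ).choose

@[simp]
theorem lift_incl (hL : L.IsAbelian) (φ : g →ₗ[k] B) (hφ : L.Commutes φ) (a : g) :
    lift hL φ hφ (L.incl a) = φ a := by
  rw [incl_apply, lift, (exists_lift hL φ hφ).choose_spec, TensorAlgebra.lift_ι_apply]

theorem commutes_incl (hL : L.IsAbelian) : L.Commutes L.incl := by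
  intro α β a ha b hb
  have h := L.quotMap_rel (EnvelopingRel.bracket α β a b ha hb)
  rw [map_sub, map_smul, map_mul, map_mul, hL a b, map_zero, map_zero, sub_eq_zero] at h
  exact h

variable (L) in
@[elab_as_elim]
theorem envelopingRing_induction {C : L.EnvelopingRing → Prop}
    (algebraMap : ∀ r, C (algebraMap k _ r)) (incl : ∀ a, C (L.incl a))
    (mul : ∀ a b, C a → C b → C (a * b)) (add : ∀ a b, C a → C b → C (a + b))
    (a : L.EnvelopingRing) : C a := by
  obtain ⟨t, rfl⟩ := L.quotMap_surjective a
  induction t using TensorAlgebra.induction with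
  | algebraMap r => rw [AlgHom.commutes]; exact algebraMap r
  | ι x => exact incl x
  | mul a b ha hb => rw [map_mul]; exact mul _ _ ha hb
  | add a b ha hb => rw [map_add]; exact add _ _ ha hb

theorem algHom_ext {f f' : L.EnvelopingRing →ₐ[k] B}
    (h : ∀ a, f (L.incl a) = f' (L.incl a)) : f = f' := by
  refine AlgHom.ext fun a => ?_
  induction a using L.envelopingRing_induction with
  | algebraMap r => rw [AlgHom.commutes, AlgHom.commutes]
  | incl a => exact h a
  | mul a b ha hb => rw [map_mul, map_mul, ha, hb]
  | add a b ha hb => rw [map_add, map_add, ha, hb]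

end Lift

/-! ### The grading by length -/

section Grading

/-- The subspace of the enveloping ring spanned by the products of `i` elements of `g`. -/
noncomputable def gradedPart (i : ℕ) : Submodule k L.EnvelopingRing := LinearMap.range L.incl ^ i

variable {L}

theorem incl_mem_gradedPart_one (a : g) : L.incl a ∈ L.gradedPart 1 := by
  rw [gradedPart, pow_one]
  exact LinearMap.mem_range_self _ a

theorem gradedPart_one : L.gradedPart 1 = LinearMap.range L.incl := pow_one _

instance :  SetLike.GradedMonoid L.gradedPart :=
  Submodule.nat_power_gradedMonoid (LinearMap.range L.incl)

open scoped DirectSum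

variable (L) in
/-- The canonical map of `g` into the degree one component. -/
noncomputable def gradedIncl : g →ₗ[k] ⨁ i, L.gradedPart i :=
  DirectSum.lof k ℕ (fun i => L.gradedPart i) 1 ∘ₗ
    L.incl.codRestrict _ incl_mem_gradedPart_one

theorem gradedIncl_apply (a : g) : L.gradedIncl a =
    DirectSum.of (fun i => L.gradedPart i) 1 ⟨L.incl a, incl_mem_gradedPart_one a⟩ := rfl

/-- With zero bracket the relations are homogeneous of length two, so they already hold inside the
degree two summand. -/
theorem commutes_gradedIncl (hL : L.IsAbelian) : L.Commutes (B := ⨁ i, L.gradedPart i) L.gradedIncl := by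
  intro α β a ha b hb
  rw [gradedIncl_apply, gradedIncl_apply, DirectSum.of_mul_of, DirectSum.of_mul_of,
    ← DirectSum.lof_eq_of k, ← DirectSum.lof_eq_of k, ← map_smul]
  congr 1
  exact Subtype.ext (commutes_incl hL α β a ha b hb)

/-- The enveloping algebra of an abelian color Lie algebra is graded by the length of products. -/
@[reducible]
noncomputable def gradedAlgebra (hL : L.IsAbelian) : GradedAlgebra L.gradedPart :=
  GradedAlgebra.ofAlgHom _ (lift (B := ⨁ i, L.gradedPart i) hL L.gradedIncl (commutes_gradedIncl hL))
    (by
      apply algHom_ext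
      intro a
      simp [gradedIncl_apply])
    fun i x => by
      obtain ⟨x, hx⟩ := x
      dsimp only
      induction hx using Submodule.pow_induction_on_left' with
      | algebraMap r =>
        rw [AlgHom.commutes, DirectSum.algebraMap_apply]; rfl
      | add x y i hx hy ihx ihy =>
        rw [map_add, ihx, ihy, ← map_add]
        rfl
      | mem_mul m hm i x hx ih =>
        obtain ⟨a, rfl⟩ := hm
        rw [map_mul, ih, lift_incl, gradedIncl_apply, DirectSum.of_mul_of]
        exact DirectSum.of_eq_of_gradedMonoid_eq (Sigma.subtype_ext (add_comm _ _) rfl)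

theorem isStandardGraded [FiniteDimensional k g] (hL : L.IsAbelian) :
    IsStandardGraded L.gradedPart where
  gradedMonoid := inferInstance
  isInternal := by
    let := gradedAlgebra hL
    exact DirectSum.Decomposition.isInternal L.gradedPart
  finite i := by
    rw [Module.Finite.iff_fg]
    exact (Module.Finite.iff_fg.mp (inferInstance : Module.Finite k (LinearMap.range L.incl))).pow i
  -- The zero map lifts to the augmentation, a ring map to the nontrivial ring `k`.
  nontrivial := (lift hL (0 : g →ₗ[k] k) fun _ _ _ _ _ _ => by simp).toRingHom.domain_nontrivial
  zero_eq := by rw [gradedPart, pow_zero, Submodule.one_eq_range]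
  adjoin_one := by
    rw [eq_top_iff]
    rintro a -
    induction a using L.envelopingRing_induction with
    | algebraMap r => exact Subalgebra.algebraMap_mem _ r
    | incl a => exact Algebra.subset_adjoin (incl_mem_gradedPart_one a)
    | mul a b ha hb => exact mul_mem ha hb
    | add a b ha hb => exact add_mem ha hb

end Grading

/-- All members of the basis `x` are homogeneous, with `x i` of degree `d i`. -/
def IsHomogeneousBasis {n : ℕ} (x : Module.Basis (Fin n) k g) (d : Fin n → Γ) : Prop :=
  ∀ i, x i ∈ L.component (d i)

/-! ### Homogeneous bases and the ideals they generate -/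

section Basis

variable {L} {n : ℕ} {x : Module.Basis (Fin n) k g} {d : Fin n → Γ}

/-- Split `a` into its part `s` along basis vectors of degree `α` and the rest `t`. Then t = a - s
has degree `α` but also lies in the sum of the other components, so it vanishes by independence. -/
theorem degree_eq_of_coord_ne_zero (hx : L.IsHomogeneousBasis x d) {α : Γ} {a : g}
    (ha : a ∈ L.component α) {j : Fin n} (hj : x.coord j a ≠ 0) : d j = α := by
  classical
  by_contra hne
  set s : g := ∑ i with d i = α, x.coord i a • x i
  set t : g := ∑ i with d i ≠ α, x.coord i a • x i
  have hst : s + t = a := by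
    rw [Finset.sum_filter_add_sum_filter_not]
    exact x.sum_repr a
  have hs : s ∈ L.component α := Submodule.sum_mem _ fun i hi =>
    Submodule.smul_mem _ _ ((Finset.mem_filter.mp hi).2 ▸ hx i)
  have ht : t ∈ ⨆ (β) (_ : β ≠ α), L.component β := Submodule.sum_mem _ fun i hi =>
    Submodule.smul_mem _ _
      (le_iSup₂ (f := fun β (_ : β ≠ α) => L.component β) (d i) (Finset.mem_filter.mp hi).2 (hx i))
  have htα : t ∈ L.component α := by
    rw [← sub_eq_of_eq_add' hst.symm]
    exact Submodule.sub_mem _ ha hs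
  have ht0 : t = 0 := (Submodule.disjoint_def.mp (L.independent α)) t htα ht
  apply hj
  rw [← hst, ht0, add_zero, map_sum]
  refine Finset.sum_eq_zero fun i hi => ?_
  have hij : i ≠ j := by rintro rfl; exact hne (Finset.mem_filter.mp hi).2
  simp [hij]

theorem coord_smul_mem (hx : L.IsHomogeneousBasis x d) {α : Γ} {a : g}
    (ha : a ∈ L.component α) (j : Fin n) : x.coord j a • x j ∈ L.component α := by
  by_cases h : x.coord j a = 0
  · simp [h]
  · exact Submodule.smul_mem _ _ (degree_eq_of_coord_ne_zero hx ha h ▸ hx j)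

/-- The algebra map to the dual numbers reading off the linear coefficient at `x j`. -/
noncomputable def dualCoord (hL : L.IsAbelian) (x : Module.Basis (Fin n) k g) (j : Fin n) :
    L.EnvelopingRing →ₐ[k] DualNumber k :=
  lift hL (TrivSqZeroExt.inrHom k k ∘ₗ x.coord j) fun _ _ _ _ _ _ => by simp

theorem dualCoord_incl (hL : L.IsAbelian) (j : Fin n) (a : g) :
    dualCoord hL x j (L.incl a) = TrivSqZeroExt.inr (x.coord j a) := by
  exact lift_incl ..

/-- The maps to the dual numbers recover every coordinate of `a` from its image. -/
theorem incl_injective (hL : L.IsAbelian) (x : Module.Basis (Fin n) k g) :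
    Function.Injective L.incl := by
  rw [injective_iff_map_eq_zero]
  intro a ha
  refine x.ext_elem fun j => ?_
  have h := dualCoord_incl hL (x := x) j a
  rw [ha, map_zero] at h
  simpa using (congrArg TrivSqZeroExt.snd h).symm

/-- `dualCoord` at `j` kills the generators indexed by `Y`, hence the ideal, but not `x j`. This
gives strictness of the flag. -/
theorem notMem_rightSpan (hL : L.IsAbelian) {Y : Set (Fin n)} {j : Fin n} (hj : j ∉ Y) :
    L.incl (x j) ∉ rightSpan ((fun i => L.incl (x i)) '' Y) := by
  intro h
  have h0 : dualCoord hL x j (L.incl (x j)) = 0 := by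
    refine rightSpan_induction (C := fun a => dualCoord hL x j a = 0) (map_zero _) ?_ ?_ _ h
    · intro a b ha hb
      rw [map_add, ha, hb, add_zero]
    · intro s hs b
      obtain ⟨i, hi, rfl⟩ := hs
      have hij : i ≠ j := by rintro rfl; exact hj hi
      simp [map_mul, dualCoord_incl, hij]
  rw [dualCoord_incl] at h0
  simpa using congrArg TrivSqZeroExt.snd h0

theorem isDegreeOneBasis (hL : L.IsAbelian) (x : Module.Basis (Fin n) k g) :
    IsDegreeOneBasis L.gradedPart (fun i => L.incl (x i)) := by
  constructor
  · exact x.linearIndependent.map' L.incl (LinearMap.ker_eq_bot.mpr (incl_injective hL x))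
  · rw [gradedPart_one, LinearMap.range_eq_map, ← x.span_eq, Submodule.map_span, ← Set.range_comp]
    rfl

/-- A product of positive length begins with an element of `g`, a combination of the `x i`. -/
theorem augmentationIdeal_eq (x : Module.Basis (Fin n) k g) :
    augmentationIdeal L.gradedPart = rightSpan (Set.range fun i => L.incl (x i)) := by
  apply le_antisymm
  · refine Submodule.span_le.mpr (Set.iUnion_subset fun i a ha => ?_)
    rw [gradedPart, pow_succ'] at ha
    change a ∈ rightSpan _
    refine Submodule.mul_induction_on ha ?_ fun a b ha hb => add_mem ha hb
    rintro _ ⟨a, rfl⟩ b -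
    apply mul_mem_of_mem
    rw [← x.sum_repr a, map_sum]
    refine Submodule.sum_mem _ fun i _ => ?_
    rw [map_smul, ← mul_one (L.incl (x i)), ← mul_smul_comm]
    exact mul_mem_of_mem (Submodule.subset_span (Set.mem_range_self i)) _
  · refine Submodule.span_mono ?_
    rintro _ ⟨i, rfl⟩
    exact Set.mem_iUnion.mpr ⟨0, incl_mem_gradedPart_one _⟩

/-- A right ideal generated by homogeneous elements of `g` is two-sided. -/
theorem mul_mem_rightSpan (hL : L.IsAbelian) (hx : L.IsHomogeneousBasis x d) (Y : Set (Fin n))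
    (r : L.EnvelopingRing) : ∀ z ∈ rightSpan ((fun i => L.incl (x i)) '' Y),
      r * z ∈ rightSpan ((fun i => L.incl (x i)) '' Y) := by
  induction r using L.envelopingRing_induction with
  | algebraMap c =>
    intro z hz
    rw [Algebra.commutes]
    exact mul_mem_of_mem hz _
  | mul a b ha hb => intro z hz; rw [mul_assoc]; exact ha _ (hb _ hz)
  | add a b ha hb => intro z hz; rw [add_mul]; exact add_mem (ha _ hz) (hb _ hz)
  | incl a =>
    intro z hz
    refine rightSpan_induction
      (C := fun z => L.incl a * z ∈ rightSpan ((fun i => L.incl (x i)) '' Y)) ?_ ?_ ?_ z hz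
    · simp
    · intro u v hu hv
      rw [mul_add]
      exact add_mem hu hv
    · intro s hs b
      obtain ⟨y, hy, rfl⟩ := hs
      rw [← x.sum_repr a, map_sum, Finset.sum_mul]
      refine Submodule.sum_mem _ fun i _ => ?_
      -- Up to a scalar, x_i x_y b = x_y x_i b, which brings the generator back to the left.
      have h := commutes_incl hL _ _ _ (hx i) _ (hx y)
      rw [map_smul, ← mul_assoc, smul_mul_assoc, h, ← smul_mul_assoc, smul_mul_assoc _ _ b,
        smul_mul_assoc, smul_mul_assoc, ← mul_smul_comm, ← mul_smul_comm, mul_assoc]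
      have hy' : L.incl (x y) ∈ rightSpan ((fun i => L.incl (x i)) '' Y) :=
        Submodule.subset_span (Set.mem_image_of_mem _ hy)
      exact mul_mem_of_mem hy' _

open Classical in
/-- The projection of `g` along the basis vectors in `Y`. -/
noncomputable def killMap (x : Module.Basis (Fin n) k g) (Y : Set (Fin n)) : g →ₗ[k] g :=
  LinearMap.id - ∑ y with y ∈ Y, (x.coord y).smulRight (x y)

theorem killMap_mem (hx : L.IsHomogeneousBasis x d) (Y : Set (Fin n)) {α : Γ} {a : g}
    (ha : a ∈ L.component α) : killMap x Y a ∈ L.component α := by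
  classical
  rw [killMap, LinearMap.sub_apply, LinearMap.sum_apply]
  exact Submodule.sub_mem _ ha (Submodule.sum_mem _ fun i _ => coord_smul_mem hx ha i)

theorem killMap_basis_of_mem {Y : Set (Fin n)} {j : Fin n} (hj : j ∈ Y) :
    killMap x Y (x j) = 0 := by
  classical
  simp [killMap, LinearMap.sum_apply, Finsupp.single_apply, hj]

theorem killMap_basis_of_notMem {Y : Set (Fin n)} {j : Fin n} (hj : j ∉ Y) :
    killMap x Y (x j) = x j := by
  classical
  simp [killMap, LinearMap.sum_apply, Finsupp.single_apply, hj]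

/-- The graded algebra endomorphism of the enveloping algebra that kills the basis vectors in `Y`
and fixes the others. -/
noncomputable def kill (hL : L.IsAbelian) (hx : L.IsHomogeneousBasis x d) (Y : Set (Fin n)) :
    L.EnvelopingRing →ₐ[k] L.EnvelopingRing :=
  lift hL (L.incl ∘ₗ killMap x Y) fun α β _ ha _ hb =>
    commutes_incl hL α β _ (killMap_mem hx Y ha) _ (killMap_mem hx Y hb)

theorem kill_incl (hL : L.IsAbelian) (hx : L.IsHomogeneousBasis x d) (Y : Set (Fin n)) (a : g) :
    kill hL hx Y (L.incl a) = L.incl (killMap x Y a) := by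
  exact lift_incl ..

theorem sub_kill_mem (hL : L.IsAbelian) (hx : L.IsHomogeneousBasis x d) (Y : Set (Fin n))
    (a : L.EnvelopingRing) : a - kill hL hx Y a ∈ rightSpan ((fun i => L.incl (x i)) '' Y) := by
  classical
  induction a using L.envelopingRing_induction with
  | algebraMap c => simp
  | add a b ha hb => rw [map_add, add_sub_add_comm]; exact add_mem ha hb
  | mul a b ha hb =>
    -- The second summand lies in the ideal only because the ideal is two-sided.
    have h : a * b - kill hL hx Y (a * b) =
        (a - kill hL hx Y a) * b + kill hL hx Y a * (b - kill hL hx Y b) := by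
      rw [map_mul]; noncomm_ring
    rw [h]
    exact add_mem (mul_mem_of_mem ha _) (mul_mem_rightSpan hL hx Y _ _ hb)
  | incl a =>
    rw [kill_incl, killMap, LinearMap.sub_apply, map_sub, LinearMap.id_apply, sub_sub_cancel,
      LinearMap.sum_apply, map_sum]
    refine Submodule.sum_mem _ fun i hi => ?_
    rw [LinearMap.smulRight_apply, map_smul, ← mul_one (L.incl (x i)), ← mul_smul_comm]
    have hi' : L.incl (x i) ∈ rightSpan ((fun i => L.incl (x i)) '' Y) :=
      Submodule.subset_span (Set.mem_image_of_mem _ (Finset.mem_filter.mp hi).2)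
    have hi' : L.incl (x i) ∈ rightSpan ((fun i => L.incl (x i)) '' Y) :=
      Submodule.subset_span (Set.mem_image_of_mem _ (Finset.mem_filter.mp hi).2)
    exact mul_mem_of_mem hi' _

theorem mem_rightSpan_iff (hL : L.IsAbelian) (hx : L.IsHomogeneousBasis x d) (Y : Set (Fin n))
    {a : L.EnvelopingRing} :
    a ∈ rightSpan ((fun i => L.incl (x i)) '' Y) ↔ kill hL hx Y a = 0 := by
  constructor
  · intro ha
    refine rightSpan_induction (C := fun a => kill hL hx Y a = 0) (map_zero _) ?_ ?_ a ha
    · intro a b ha hb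
      rw [map_add, ha, hb, add_zero]
    · intro s hs b
      obtain ⟨y, hy, rfl⟩ := hs
      rw [map_mul, kill_incl, killMap_basis_of_mem hy, map_zero, zero_mul]
  · intro ha
    simpa [ha] using sub_kill_mem hL hx Y a

end Basis

/-! ### Skew derivations from triangular matrices -/

section SkewDerivation

variable {L} {n : ℕ} {x : Module.Basis (Fin n) k g} {d : Fin n → Γ}

open Classical in
/-- The diagonal map of `g` that multiplies `x i` by `ε (d i) (d j)` for `i ≠ j` and `x j`
by `c`. -/
noncomputable def twist (ε : CommutationFactor k Γ) (x : Module.Basis (Fin n) k g) (d : Fin n → Γ)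
    (j : Fin n) (c : k) : g →ₗ[k] g :=
  x.constr k fun i => (if i = j then c else (ε (d i) (d j) : k)) • x i

/-- Only basis vectors of degree `α` occur in `a`, so `twist` is the scalar ε(α, d j) there,
corrected along `x j`. -/
theorem twist_apply (hx : L.IsHomogeneousBasis x d) (j : Fin n) (c : k) {α : Γ} {a : g}
    (ha : a ∈ L.component α) :
    twist ε x d j c a = (ε α (d j) : k) • a + ((c - (ε α (d j) : k)) * x.coord j a) • x j := by
  classical
  have h1 : ∀ i, x.coord i a • ((if i = j then c else (ε (d i) (d j) : k)) • x i) =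
      (ε α (d j) : k) • (x.coord i a • x i) +
        if i = j then ((c - (ε α (d j) : k)) * x.coord j a) • x j else 0 := by
    intro i
    by_cases hi : x.coord i a = 0
    · by_cases hij : i = j
      · subst hij; simp [hi]
      · simp [hi, hij]
    · rw [degree_eq_of_coord_ne_zero hx ha hi]
      split_ifs with hij
      · subst hij; module
      · module
  rw [twist, Module.Basis.constr_apply_fintype]
  simp only [Module.Basis.equivFun_apply]
  simp only [Module.Basis.coord_apply] at h1
  rw [Finset.sum_congr rfl fun i _ => h1 i, Finset.sum_add_distrib, ← Finset.smul_sum, x.sum_repr]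
  simp

theorem twist_mem (hx : L.IsHomogeneousBasis x d) (j : Fin n) (c : k) {α : Γ} {a : g}
    (ha : a ∈ L.component α) : twist ε x d j c a ∈ L.component α := by
  rw [twist_apply hx j c ha, mul_smul]
  exact add_mem (Submodule.smul_mem _ _ ha) (Submodule.smul_mem _ _ (coord_smul_mem hx ha j))

/-- The map `a ↦ !![a, 0; coord j a, twist a]`. Its extension to the enveloping algebra encodes
a skew derivation dual to `x j`. -/
noncomputable def skewMatrix (L : ColorLieAlgebra ε g) (x : Module.Basis (Fin n) k g)
    (d : Fin n → Γ) (j : Fin n) (c : k) : g →ₗ[k] Matrix (Fin 2) (Fin 2) L.EnvelopingRing where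
  toFun a := !![L.incl a, 0; algebraMap k _ (x.coord j a), L.incl (twist ε x d j c a)]
  map_add' a b := by
    ext i l; fin_cases i <;> fin_cases l <;> simp
  map_smul' r a := by
    ext i l; fin_cases i <;> fin_cases l <;> simp [Algebra.smul_def]

/-- The diagonal entries commute correctly because `twist` preserves degrees. The condition on `c`
serves the lower left entry, treated in `key`. -/
theorem commutes_skewMatrix (hL : L.IsAbelian) (hx : L.IsHomogeneousBasis x d) (j : Fin n) (c : k)
    (hc : (ε (d j) (d j) : k) = 1 ∨ (ε (d j) (d j) : k) = -1 ∧ c = -1) :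
    L.Commutes (skewMatrix L x d j c) := by
  intro α β a ha b hb
  have key : algebraMap k L.EnvelopingRing (x.coord j a) * L.incl b +
      L.incl (twist ε x d j c a) * algebraMap k L.EnvelopingRing (x.coord j b) =
      (ε α β : k) • (algebraMap k L.EnvelopingRing (x.coord j b) * L.incl a +
      L.incl (twist ε x d j c b) * algebraMap k L.EnvelopingRing (x.coord j a)) := by
    rw [← Algebra.commutes (x.coord j b) (L.incl (twist ε x d j c a)),
      ← Algebra.commutes (x.coord j a) (L.incl (twist ε x d j c b))]
    simp only [← Algebra.smul_def, ← map_smul L.incl, ← map_add]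
    apply congrArg L.incl
    rw [twist_apply hx j c ha, twist_apply hx j c hb]
    by_cases ha0 : x.coord j a = 0
    · by_cases hb0 : x.coord j b = 0
      · simp [ha0, hb0]
      · obtain rfl := degree_eq_of_coord_ne_zero hx hb hb0
        simp only [ha0]
        module
    · obtain rfl := degree_eq_of_coord_ne_zero hx ha ha0
      by_cases hb0 : x.coord j b = 0
      · simp only [hb0]
        have h := ε.coe_mul_swap (d j) β
        match_scalars
        · linear_combination (-x.coord j a) * h
        · ring
        · ring
      -- Both degrees are now `d j`. With e = ε(d j, d j), so that e² = 1, the two sides differ by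
      -- (1 - e)(c - e) a_j b_j x_j; hence e = 1 with `c` free, or c = e = -1.
      · obtain rfl := degree_eq_of_coord_ne_zero hx hb hb0
        rcases hc with h | ⟨h, rfl⟩
        · rw [h]; module
        · rw [h]; module
  ext i l
  fin_cases i <;> fin_cases l
  · simpa [skewMatrix] using commutes_incl hL α β a ha b hb
  · simp [skewMatrix]
  · change (skewMatrix L x d j c a * skewMatrix L x d j c b) 1 0 =
      ((ε α β : k) • (skewMatrix L x d j c b * skewMatrix L x d j c a)) 1 0
    rw [Matrix.smul_apply, Matrix.mul_apply, Matrix.mul_apply, Fin.sum_univ_two, Fin.sum_univ_two]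
    exact key
  · simpa [skewMatrix, Matrix.mul_fin_two] using
      commutes_incl hL α β _ (twist_mem hx j c ha) _ (twist_mem hx j c hb)

/-- For suitable `c` there is a linear map `D` with `D (x j * b) = b + c * x j * D b`. -/
theorem exists_skewDerivation (hL : L.IsAbelian) (hx : L.IsHomogeneousBasis x d) (j : Fin n)
    (c : k) (hc : (ε (d j) (d j) : k) = 1 ∨ (ε (d j) (d j) : k) = -1 ∧ c = -1) :
    ∃ D : L.EnvelopingRing → L.EnvelopingRing, D 0 = 0 ∧
      ∀ b, D (L.incl (x j) * b) = b + c • (L.incl (x j) * D b) := by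
  set Φ := lift hL (skewMatrix L x d j c) (commutes_skewMatrix hL hx j c hc) with hΦ
  -- The top row of Φ(b) is (b, 0), so the lower left entry satisfies D(ab) = D(a) b + Φ(a)₁₁ D(b).
  have h0 : ∀ b, Φ b 0 0 = b ∧ Φ b 0 1 = 0 := by
    intro b
    induction b using L.envelopingRing_induction with
    | algebraMap r => simp [Matrix.algebraMap_matrix_apply]
    | incl a => simp [hΦ, skewMatrix]
    | mul a b ha hb => simp [Matrix.mul_apply, ha, hb]
    | add a b ha hb => simp [ha, hb]
  refine ⟨fun b => Φ b 1 0, by simp, fun b => ?_⟩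
  have hj : twist ε x d j c (x j) = c • x j := by
    rw [twist, Module.Basis.constr_basis, if_pos rfl]
  have hΦj : Φ (L.incl (x j)) = !![L.incl (x j), 0; 1, c • L.incl (x j)] := by
    simp [hΦ, skewMatrix, hj]
  simp [hΦj, Matrix.mul_apply, (h0 b).1]

end SkewDerivation

/-! ### Annihilators and colon ideals -/

section Colon

variable {L} {n : ℕ} {x : Module.Basis (Fin n) k g} {d : Fin n → Γ}

/-- A basis vector of even degree is a left nonzerodivisor. -/
theorem eq_zero_of_mul_eq_zero (hL : L.IsAbelian) (hx : L.IsHomogeneousBasis x d) {j : Fin n}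
    (hj : (ε (d j) (d j) : k) = 1) {b : L.EnvelopingRing} (hb : L.incl (x j) * b = 0) : b = 0 := by
  -- With c = 0, `D` is a left inverse of multiplication by `x j`.
  obtain ⟨D, hD0, hD⟩ := exists_skewDerivation hL hx j 0 (Or.inl hj)
  have h := hD b
  rw [hb, hD0] at h
  simpa using h.symm

/-- The annihilator of a basis vector of odd degree is the right ideal it generates. -/
theorem exists_eq_mul_of_mul_eq_zero (hL : L.IsAbelian) (hx : L.IsHomogeneousBasis x d)
    {j : Fin n} (hj : (ε (d j) (d j) : k) = -1) {b : L.EnvelopingRing} (hb : L.incl (x j) * b = 0) :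
    ∃ b', b = L.incl (x j) * b' := by
  -- With c = -1, x_j b = 0 gives 0 = b - x_j D(b).
  obtain ⟨D, hD0, hD⟩ := exists_skewDerivation hL hx j (-1) (Or.inr ⟨hj, rfl⟩)
  have h := hD b
  rw [hb, hD0, neg_one_smul, ← sub_eq_add_neg] at h
  exact ⟨D b, sub_eq_zero.mp h.symm⟩

theorem incl_mul_self_eq_zero (h2 : (2 : k) ≠ 0) (hL : L.IsAbelian)
    (hx : L.IsHomogeneousBasis x d) {j : Fin n} (hj : (ε (d j) (d j) : k) = -1) :
    L.incl (x j) * L.incl (x j) = 0 := by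
  have h := commutes_incl hL _ _ _ (hx j) _ (hx j)
  rw [hj, neg_one_smul, eq_neg_iff_add_eq_zero, ← two_smul k] at h
  exact (smul_eq_zero.mp h).resolve_left h2

theorem rightColon_of_even (hL : L.IsAbelian) (hx : L.IsHomogeneousBasis x d) {Y : Set (Fin n)}
    {j : Fin n} (hjY : j ∉ Y) (hj : (ε (d j) (d j) : k) = 1) :
    rightColon (L.incl (x j)) (rightSpan ((fun i => L.incl (x i)) '' Y)) =
      rightSpan ((fun i => L.incl (x i)) '' Y) := by
  ext a
  refine ⟨fun ha => ?_, mul_mem_rightSpan hL hx Y _ _⟩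
  change L.incl (x j) * a ∈ rightSpan _ at ha
  rw [mem_rightSpan_iff hL hx, map_mul, kill_incl, killMap_basis_of_notMem hjY] at ha
  rw [mem_rightSpan_iff hL hx]
  exact eq_zero_of_mul_eq_zero hL hx hj ha

/-- If x_j a lies in the ideal of `Y`, then `kill` sends `a` into the annihilator of `x j`, that is
x_j A, and changes `a` only by an element of the ideal. Conversely x_j² = 0, as 2 is invertible. -/
theorem rightColon_of_odd (h2 : (2 : k) ≠ 0) (hL : L.IsAbelian) (hx : L.IsHomogeneousBasis x d)
    {Y : Set (Fin n)} {j : Fin n} (hjY : j ∉ Y) (hj : (ε (d j) (d j) : k) = -1) :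
    rightColon (L.incl (x j)) (rightSpan ((fun i => L.incl (x i)) '' Y)) =
      rightSpan ((fun i => L.incl (x i)) '' insert j Y) := by
  rw [Set.image_insert_eq]
  apply le_antisymm
  · intro a ha
    change L.incl (x j) * a ∈ rightSpan _ at ha
    rw [mem_rightSpan_iff hL hx, map_mul, kill_incl, killMap_basis_of_notMem hjY] at ha
    obtain ⟨b, hb⟩ := exists_eq_mul_of_mul_eq_zero hL hx hj ha
    rw [← sub_add_cancel a (kill hL hx Y a), hb]
    refine add_mem ?_ (mul_mem_of_mem (Submodule.subset_span (Set.mem_insert _ _)) _)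
    rw [← hb]
    exact Submodule.span_mono (Set.subset_insert _ _) (sub_kill_mem hL hx Y a)
  · refine Submodule.span_le.mpr (Set.insert_subset ?_ fun a ha => ?_)
    · change L.incl (x j) * L.incl (x j) ∈ rightSpan _
      rw [incl_mul_self_eq_zero h2 hL hx hj]
      exact zero_mem _
    · exact mul_mem_rightSpan hL hx Y _ _ (Submodule.subset_span ha)

theorem rightColon_eq_or (h2 : (2 : k) ≠ 0) (hL : L.IsAbelian) (hx : L.IsHomogeneousBasis x d)
    {Y : Set (Fin n)} {j : Fin n} (hjY : j ∉ Y) :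
    rightColon (L.incl (x j)) (rightSpan ((fun i => L.incl (x i)) '' Y)) =
        rightSpan ((fun i => L.incl (x i)) '' Y) ∨
      rightColon (L.incl (x j)) (rightSpan ((fun i => L.incl (x i)) '' Y)) =
        rightSpan ((fun i => L.incl (x i)) '' insert j Y) :=
  (ε.self_eq_one_or (d j)).imp (rightColon_of_even hL hx hjY) (rightColon_of_odd h2 hL hx hjY)

end Colon

/-! ### The flag and the Koszul properties -/

section Main

variable {L} {n : ℕ} {x : Module.Basis (Fin n) k g} {d : Fin n → Γ}

theorem setOf_lt_succ (i : Fin n) :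
    {j : Fin n | (j : ℕ) < i.succ} = insert i {j : Fin n | (j : ℕ) < i.castSucc} := by
  ext j
  simp only [Set.mem_ofPred_eq, Set.mem_insert_iff, Fin.val_succ, Fin.val_castSucc, Fin.ext_iff]
  omega

theorem flagOf_succ (i : Fin n) : flagOf (fun i => L.incl (x i)) i.succ =
    flagOf (fun i => L.incl (x i)) i.castSucc ⊔ rightSpan {L.incl (x i)} := by
  rw [flagOf, flagOf, setOf_lt_succ, Set.image_insert_eq, Set.insert_eq, sup_comm]
  exact Submodule.span_union _ _

theorem flagOf_strictMono (hL : L.IsAbelian) (x : Module.Basis (Fin n) k g) :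
    StrictMono (flagOf fun i => L.incl (x i)) := by
  refine Fin.strictMono_iff_lt_succ.mpr fun i => ?_
  rw [flagOf_succ]
  refine lt_of_le_of_ne le_sup_left fun h => ?_
  have hi : L.incl (x i) ∈ flagOf (fun i => L.incl (x i)) i.castSucc := by
    rw [h]
    exact Submodule.mem_sup_right (Submodule.subset_span rfl)
  exact notMem_rightSpan hL (by simp) hi

theorem flagOf_zero : flagOf (fun i => L.incl (x i)) 0 = ⊥ := by
  simp [flagOf]

theorem flagOf_last :
    flagOf (fun i => L.incl (x i)) (Fin.last n) = augmentationIdeal L.gradedPart := by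
  rw [augmentationIdeal_eq x, flagOf, ← Set.image_univ]
  congr 2
  ext j
  simp

theorem isKoszulFiltration (h2 : (2 : k) ≠ 0) (hL : L.IsAbelian)
    (hx : L.IsHomogeneousBasis x d) :
    IsKoszulFiltration L.gradedPart (Set.range (flagOf fun i => L.incl (x i))) where
  degree_one_generated := by
    rintro _ ⟨i, rfl⟩
    refine ⟨_, ?_, rfl⟩
    rintro _ ⟨j, -, rfl⟩
    exact incl_mem_gradedPart_one _
  bot_mem := ⟨0, flagOf_zero⟩
  augmentation_mem := ⟨Fin.last n, flagOf_last⟩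
  step := by
    rintro _ ⟨i, rfl⟩ hi
    cases i using Fin.cases with
    | zero => exact absurd flagOf_zero hi
    | succ i =>
      refine ⟨_, ⟨i.castSucc, rfl⟩, ((flagOf_strictMono hL x) i.castSucc_lt_succ).ne', L.incl (x i),
        incl_mem_gradedPart_one _, flagOf_succ i, ?_⟩
      -- The colon ideal is the preceding flag member in the even case and the current one in the
      -- odd case.
      rcases rightColon_eq_or h2 hL hx (Y := {j : Fin n | (j : ℕ) < i.castSucc}) (j := i)
        (by simp) with h | h
      · exact ⟨i.castSucc, h.symm⟩
      · exact ⟨i.succ, by rw [← setOf_lt_succ] at h; exact h.symm⟩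

theorem isInitiallyKoszulWRT [FiniteDimensional k g] (h2 : (2 : k) ≠ 0) (hL : L.IsAbelian)
    (hx : L.IsHomogeneousBasis x d) :
    IsInitiallyKoszulWRT L.gradedPart (fun i => L.incl (x i)) :=
  ⟨isStandardGraded hL, isDegreeOneBasis hL x,
    { finrank_eq := by
        rw [gradedPart_one, LinearMap.finrank_range_of_inj (incl_injective hL x),
          Module.finrank_eq_card_basis x, Fintype.card_fin]
      strictMono := flagOf_strictMono hL x
      zero_eq := flagOf_zero
      last_eq := flagOf_last
      isKoszulFiltration := isKoszulFiltration h2 hL hx }⟩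

theorem isStronglyKoszul [FiniteDimensional k g] (h2 : (2 : k) ≠ 0) (hL : L.IsAbelian)
    (hx : L.IsHomogeneousBasis x d) : IsStronglyKoszul L.gradedPart :=
  ⟨isStandardGraded hL, n, _, isDegreeOneBasis hL x, fun Y _ hj =>
    (rightColon_eq_or h2 hL hx hj).elim (fun h => ⟨Y, h⟩) fun h => ⟨_, h⟩⟩

variable (L) in
theorem exists_isHomogeneousBasis [FiniteDimensional k g] (hn : Module.finrank k g = n) :
    ∃ (x : Module.Basis (Fin n) k g) (d : Fin n → Γ), L.IsHomogeneousBasis x d := by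
  classical
  have hI : DirectSum.IsInternal L.component :=
    DirectSum.isInternal_submodule_of_iSupIndep_of_iSup_eq_top L.independent L.iSup_eq_top
  let b := hI.collectedBasis fun γ => Module.Basis.ofVectorSpace k (L.component γ)
  have := Module.Finite.finite_basis b
  let := Fintype.ofFinite (Σ γ, Module.Basis.ofVectorSpaceIndex k (L.component γ))
  let e := Fintype.equivFinOfCardEq ((Module.finrank_eq_card_basis b).symm.trans hn)
  refine ⟨b.reindex e, fun i => (e.symm i).1, fun i => ?_⟩
  rw [Module.Basis.reindex_apply]
  exact hI.collectedBasis_mem _ _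

end Main

end ColorLieAlgebra

end ColorKoszul

theorem mainTheorem8 {k Γ g : Type*} [Field k] (h2 : (2 : k) ≠ 0) (h3 : (3 : k) ≠ 0)
    [AddCommGroup Γ] (ε : ColorKoszul.CommutationFactor k Γ)
    [AddCommGroup g] [Module k g] [FiniteDimensional k g]
    (L : ColorKoszul.ColorLieAlgebra ε g) (hL : L.IsAbelian)
    (n : ℕ) (hn : Module.finrank k g = n) :
    ColorKoszul.IsInitiallyKoszul L.degreePart ∧
    (∀ x : Fin n → g, (∀ i, L.IsHomogeneous (x i)) → Submodule.span k (Set.range x) = ⊤ →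
      ColorKoszul.IsInitiallyKoszulWRT L.degreePart (fun i => L.ι (x i))) ∧
    ColorKoszul.IsStronglyKoszul L.degreePart := by
  obtain ⟨b, d, hb⟩ := L.exists_isHomogeneousBasis hn
  have hb' := ColorKoszul.ColorLieAlgebra.isInitiallyKoszulWRT h2 hL hb
  -- Results on `EnvelopingRing` and `gradedPart` transfer to `Enveloping` and `degreePart` by
  -- unfolding definitions.
  refine ⟨⟨hb'.1, n, _, hb'.2.2⟩, fun x hx hspan => ?_,
    ColorKoszul.ColorLieAlgebra.isStronglyKoszul h2 hL hb⟩
  choose d hd using hx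
  let y := basisOfTopLeSpanOfCardEqFinrank x hspan.ge (by simp [hn])
  have hy : L.IsHomogeneousBasis y d := fun i => by simpa [y] using hd i
  have h := ColorKoszul.ColorLieAlgebra.isInitiallyKoszulWRT h2 hL hy
  rw [show (fun i => L.incl (y i)) = fun i => L.incl (x i) from funext fun i => by simp [y]] at h
  exact h
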